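/- **(1)** Let $(\mathcal V,\otimes,I)$ be a symmetric monoidal closed category and let $\mathcal K$ be a $\mathcal V$-enriched category with reflexive coequalizers (conical coequalizers of parallel pairs having a common section). Let $G$ be an object of $\mathcal K$ which has tensors, i.e. the enriched hom-functor $\mathcal K(G,-)\colon\mathcal K\to\mathcal V$ has a left adjoint $P\mapsto P\otimes G$, and suppose that the full subcategory $\mathcal A$ of $\mathcal K$ formed by all finite (conical) copowers of $G$ is dense, i.e. the functor $\mathcal K\to[\mathcal A^{\mathrm{op}},\mathcal V]$, $X\mapsto\mathcal K(-,X)|_{\mathcal A^{\mathrm{op}}}$, is fully faithful in the enriched sense. If $\mathcal V$ is complete, then so is $\mathcal K$; if $\mathcal V$ is cocomplete, then so is $\mathcal K$. **(2)** Let $\mathcal K$ be an order-enriched category (every hom-set is partially ordered and composition is monotone) such that - every morphism $h\colon A\to B$ has a subkernel pair, i.e. a pair $r_0,r_1\colon R\to A$ with $h r_0\le h r_1$ such that every pair $v_0,v_1\colon S\to A$ with $h v_0\le h v_1$ has the form $v_i=r_i t$ for some $t\colon S\to R$, and $r_0t\le r_0t'$, $r_1t\le r_1t'$ imply $t\le t'$;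 - every reflexive pair $f_0,f_1\colon X\to Y$ (one with a common section) has a coinserter, i.e. a morphism $c\colon Y\to C$ with $c f_0\le c f_1$ such that every $c'\colon Y\to C'$ with $c'f_0\le c'f_1$ factorizes through $c$, and $u_0c\le u_1c$ implies $u_0\le u_1$; - there is a subvarietal generator $G$, i.e. an object $G$ such that: (a) $G$ is a strong generator: its hom-functor to the category of posets reflects isomorphisms; (b) for every set $M$ the (conical) copower $M\cdot G$ exists; (c) $G$ is abstractly finite: every morphism $G\to M\cdot G$ factorizes through the canonical morphism $M_0\cdot G\to M\cdot G$ for some finite subset $M_0\subseteq M$; (d) $G$ is a subregular projective: for every coinserter $e\colon A\to B$ of a reflexive pair, every morphism $G\to B$ factorizes through $e$. Then $\mathcal K$ is complete and cocomplete. Here an enriched category is called complete (cocomplete) if it has all limits (colimits) weighted by small weights, in the enriched sense; $\mathcal V$ is complete (cocomplete) if it has all ordinary small limits (colimits). -/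

import Mathlib

open CategoryTheory MonoidalCategory Opposite

universe u₀ v₀ u₁ v₁ u₂ v₂

/-! ## Notions for categories enriched over a symmetric monoidal closed category `V`

Composition is written in diagrammatic order, `eComp V X Y Z : K(X,Y) ⊗ K(Y,Z) ⟶ K(X,Z)`. Every
universal property below is enriched: an isomorphism from a hom-object `K(X,Y)` to some other object
of `V` is expressed by its effect on generalized elements `Z ⟶ K(X,Y)`, for all `Z` in `V`. -/

namespace EnrichedNotions

section Conical

variable (V : Type u₁) [Category.{v₁} V] [MonoidalCategory V]
variable {K : Type u₂} [Category.{v₂} K] [EnrichedOrdinaryCategory V K]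

/-- `c : X ⟶ Q` is a (conical) coequalizer of `f` and `g`: for every `Y`, the morphism
`K(c,Y) : K(Q,Y) ⟶ K(X,Y)` is the equalizer in `V` of `K(f,Y)` and `K(g,Y)`. -/
def IsCoequalizer {R X Q : K} (f g : R ⟶ X) (c : X ⟶ Q) : Prop :=
  f ≫ c = g ≫ c ∧
    ∀ (Y : K) (Z : V) (h : Z ⟶ (X ⟶[V] Y)),
      h ≫ eHomWhiskerRight V f Y = h ≫ eHomWhiskerRight V g Y →
        ∃! k : Z ⟶ (Q ⟶[V] Y), k ≫ eHomWhiskerRight V c Y = h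

variable (K) in
/-- Every reflexive pair (a parallel pair of morphisms with a common section) has a (conical)
coequalizer. -/
def HasReflexiveCoequalizers : Prop :=
  ∀ ⦃R X : K⦄ (f g : R ⟶ X), (∃ d : X ⟶ R, d ≫ f = 𝟙 X ∧ d ≫ g = 𝟙 X) →
    ∃ (Q : K) (c : X ⟶ Q), IsCoequalizer V f g c

/-- The morphisms `ι m : G ⟶ X`, `m ∈ M`, exhibit `X` as the (conical) copower `M · G`: for every
`Y`, the morphisms `K(ι m, Y)` exhibit `K(X,Y)` as the product in `V` of `M` copies of `K(G,Y)`. -/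
def IsCopower {M : Type u₀} {G X : K} (ι : M → (G ⟶ X)) : Prop :=
  ∀ (Y : K) (Z : V) (h : M → (Z ⟶ (G ⟶[V] Y))),
    ∃! k : Z ⟶ (X ⟶[V] Y), ∀ m, k ≫ eHomWhiskerRight V (ι m) Y = h m

/-- `X` is a finite copower `G + ⋯ + G` of `G` (with any finite number of summands, possibly `0`). -/
def IsFiniteCopower (G X : K) : Prop :=
  ∃ (n : ℕ) (ι : Fin n → (G ⟶ X)), IsCopower V ι

/-- `η : P ⟶ K(G,T)` exhibits `T` as the tensor `P ⊗ G`: for every `Y`, the morphism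
`K(T,Y) ⟶ [P, K(G,Y)]` induced by `η` is an isomorphism. -/
def IsTensor {P : V} {G T : K} (η : P ⟶ (G ⟶[V] T)) : Prop :=
  ∀ (Y : K) (Z : V) (h : P ⊗ Z ⟶ (G ⟶[V] Y)),
    ∃! k : Z ⟶ (T ⟶[V] Y), (η ⊗ₘ k) ≫ eComp V G T Y = h

/-- The object `G` has tensors: all tensors `P ⊗ G`, `P ∈ V`, exist. Equivalently, the enriched
hom-functor `K(G,-) : K → V` has a left adjoint. -/
def HasTensors (G : K) : Prop :=
  ∀ P : V, ∃ (T : K) (η : P ⟶ (G ⟶[V] T)), IsTensor V η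

/-- `V`-natural families `K(A,X) ⊗ Z ⟶ K(A,Y)`, for `A` in the full subcategory `𝒜` of `K`, that is,
generalized elements with domain `Z` of the object of `V`-natural transformations from
`K(-,X)` to `K(-,Y)`, both restricted to `𝒜ᵒᵖ`. -/
def IsNaturalOn (𝒜 : K → Prop) {X Y : K} {Z : V}
    (φ : ∀ A : K, 𝒜 A → ((A ⟶[V] X) ⊗ Z ⟶ (A ⟶[V] Y))) : Prop :=
  ∀ (A B : K) (hA : 𝒜 A) (hB : 𝒜 B),
    eComp V B A X ▷ Z ≫ φ B hB =
      (α_ (B ⟶[V] A) (A ⟶[V] X) Z).hom ≫ (B ⟶[V] A) ◁ φ A hA ≫ eComp V B A Y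

/-- The full subcategory of `K` on the objects satisfying `𝒜` is dense: the functor
`E : K → [𝒜ᵒᵖ, V]` sending `X` to the restriction of `K(-,X)` is (`V`-)fully faithful. -/
def IsDense (𝒜 : K → Prop) : Prop :=
  ∀ (X Y : K) (Z : V) (φ : ∀ A : K, 𝒜 A → ((A ⟶[V] X) ⊗ Z ⟶ (A ⟶[V] Y))),
    IsNaturalOn V 𝒜 φ →
      ∃! k : Z ⟶ (X ⟶[V] Y), ∀ (A : K) (hA : 𝒜 A), (A ⟶[V] X) ◁ k ≫ eComp V A X Y = φ A hA

end Conical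

section Weighted

variable {V : Type u₁} [Category.{v₁} V] [MonoidalCategory V] [MonoidalClosed V]
variable {J : Type u₀} [EnrichedCategory V J]
variable {K : Type u₂} [EnrichedCategory V K]

open scoped MonoidalClosed

/-- `V`-natural families `Z ⊗ W j ⟶ K(X, D j)`, for a weight `W : J → V` and a diagram `D : J → K`:
generalized elements with domain `Z` of the object of `V`-natural transformations from `W` to
`K(X, D -)`. -/
def IsWeightedConeFamily (W : EnrichedFunctor V J V) (D : EnrichedFunctor V J K) (X : K) (Z : V)
    (φ : ∀ j : J, Z ⊗ W.obj j ⟶ (X ⟶[V] D.obj j)) : Prop :=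
  ∀ i j : J,
    (α_ Z (W.obj i) (i ⟶[V] j)).hom ≫ Z ◁ MonoidalClosed.uncurry (W.map i j) ≫ φ j =
      (φ i ⊗ₘ D.map i j) ≫ eComp V X (D.obj i) (D.obj j)

/-- `L` with the `V`-natural family `π j : W j ⟶ K(L, D j)` is the limit of `D` weighted by `W`: for
every `X`, the family `π` induces an isomorphism from `K(X,L)` to the object of `V`-natural
transformations from `W` to `K(X, D -)`. -/
def IsWeightedLimit (W : EnrichedFunctor V J V) (D : EnrichedFunctor V J K) (L : K)
    (π : ∀ j : J, W.obj j ⟶ (L ⟶[V] D.obj j)) : Prop :=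
  (∀ i j : J, MonoidalClosed.uncurry (W.map i j) ≫ π j =
    (π i ⊗ₘ D.map i j) ≫ eComp V L (D.obj i) (D.obj j)) ∧
  ∀ (X : K) (Z : V) (φ : ∀ j : J, Z ⊗ W.obj j ⟶ (X ⟶[V] D.obj j)),
    IsWeightedConeFamily W D X Z φ →
      ∃! k : Z ⟶ (X ⟶[V] L), ∀ j : J, (k ⊗ₘ π j) ≫ eComp V X L (D.obj j) = φ j

variable [BraidedCategory V]

/-- The action `J(i,j) ⊗ W j ⟶ W i` of a weight `W : Jᵒᵖ → V`. -/
def weightAct (W : EnrichedFunctor V Jᵒᵖ V) (i j : J) :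
    (i ⟶[V] j) ⊗ W.obj (op j) ⟶ W.obj (op i) :=
  (β_ (i ⟶[V] j) (W.obj (op j))).hom ≫ MonoidalClosed.uncurry (W.map (op j) (op i))

/-- `V`-natural families `W j ⊗ Z ⟶ K(D j, X)`, for a weight `W : Jᵒᵖ → V` and a diagram
`D : J → K`: generalized elements with domain `Z` of the object of `V`-natural transformations from
`W` to `K(D -, X)`. -/
def IsWeightedCoconeFamily (W : EnrichedFunctor V Jᵒᵖ V) (D : EnrichedFunctor V J K) (X : K) (Z : V)
    (φ : ∀ j : J, W.obj (op j) ⊗ Z ⟶ (D.obj j ⟶[V] X)) : Prop :=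
  ∀ i j : J,
    weightAct W i j ▷ Z ≫ φ i =
      (α_ (i ⟶[V] j) (W.obj (op j)) Z).hom ≫ (D.map i j ⊗ₘ φ j) ≫ eComp V (D.obj i) (D.obj j) X

/-- `C` with the `V`-natural family `ι j : W j ⟶ K(D j, C)` is the colimit of `D` weighted by `W`:
for every `X`, the family `ι` induces an isomorphism from `K(C,X)` to the object of `V`-natural
transformations from `W` to `K(D -, X)`. -/
def IsWeightedColimit (W : EnrichedFunctor V Jᵒᵖ V) (D : EnrichedFunctor V J K) (C : K)
    (ι : ∀ j : J, W.obj (op j) ⟶ (D.obj j ⟶[V] C)) : Prop :=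
  (∀ i j : J, weightAct W i j ≫ ι i =
    (D.map i j ⊗ₘ ι j) ≫ eComp V (D.obj i) (D.obj j) C) ∧
  ∀ (X : K) (Z : V) (φ : ∀ j : J, W.obj (op j) ⊗ Z ⟶ (D.obj j ⟶[V] X)),
    IsWeightedCoconeFamily W D X Z φ →
      ∃! k : Z ⟶ (C ⟶[V] X), ∀ j : J, (ι j ⊗ₘ k) ≫ eComp V (D.obj j) C X = φ j

variable (V K)

/-- The `V`-category `K` is complete: it has all small weighted limits. (A `V`-category is small if
its objects form a small set.) -/
def IsComplete : Prop :=
  ∀ (J : Type v₁) [EnrichedCategory V J] (W : EnrichedFunctor V J V) (D : EnrichedFunctor V J K),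
    ∃ (L : K) (π : ∀ j : J, W.obj j ⟶ (L ⟶[V] D.obj j)), IsWeightedLimit W D L π

/-- The `V`-category `K` is cocomplete: it has all small weighted colimits. -/
def IsCocomplete : Prop :=
  ∀ (J : Type v₁) [EnrichedCategory V J] (W : EnrichedFunctor V Jᵒᵖ V) (D : EnrichedFunctor V J K),
    ∃ (C : K) (ι : ∀ j : J, W.obj (op j) ⟶ (D.obj j ⟶[V] C)), IsWeightedColimit W D C ι

end Weighted

end EnrichedNotions

/-! ## Notions for order-enriched categories -/

/-- An order-enriched category: every hom-set is partially ordered and composition is monotone. -/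
class OrderEnriched (K : Type u₁) [Category.{v₁} K] where
  homOrder (X Y : K) : PartialOrder (X ⟶ Y)
  comp_le_comp {X Y Z : K} {f f' : X ⟶ Y} {g g' : Y ⟶ Z} :
    f ≤ f' → g ≤ g' → f ≫ g ≤ f' ≫ g'

attribute [reducible, instance] OrderEnriched.homOrder

namespace OrderNotions

section Basic

variable {K : Type u₁} [Category.{v₁} K] [OrderEnriched K]

/-- `c` is a coinserter of `f₀, f₁`: it is universal with respect to `c · f₀ ≤ c · f₁`. -/
structure IsCoinserter {X Y C : K} (f₀ f₁ : X ⟶ Y) (c : Y ⟶ C) : Prop where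
  le : f₀ ≫ c ≤ f₁ ≫ c
  factors : ∀ ⦃C' : K⦄ (c' : Y ⟶ C'), f₀ ≫ c' ≤ f₁ ≫ c' → ∃ h : C ⟶ C', c ≫ h = c'
  reflects : ∀ ⦃U : K⦄ (u₀ u₁ : C ⟶ U), c ≫ u₀ ≤ c ≫ u₁ → u₀ ≤ u₁

/-- A parallel pair is reflexive if its members have a common section. -/
def IsReflexive {X Y : K} (f₀ f₁ : X ⟶ Y) : Prop :=
  ∃ d : Y ⟶ X, d ≫ f₀ = 𝟙 Y ∧ d ≫ f₁ = 𝟙 Y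

/-- `r₀, r₁ : R ⟶ A` is a subkernel pair of `h`: it is universal with respect to
`h · r₀ ≤ h · r₁`. -/
structure IsSubkernelPair {R A B : K} (h : A ⟶ B) (r₀ r₁ : R ⟶ A) : Prop where
  le : r₀ ≫ h ≤ r₁ ≫ h
  factors : ∀ ⦃S : K⦄ (v₀ v₁ : S ⟶ A), v₀ ≫ h ≤ v₁ ≫ h →
    ∃ t : S ⟶ R, t ≫ r₀ = v₀ ∧ t ≫ r₁ = v₁
  reflects : ∀ ⦃S : K⦄ (t t' : S ⟶ R), t ≫ r₀ ≤ t' ≫ r₀ → t ≫ r₁ ≤ t' ≫ r₁ → t ≤ t'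

variable (K) in
/-- Every morphism has a subkernel pair. -/
def HasSubkernelPairs : Prop :=
  ∀ ⦃A B : K⦄ (h : A ⟶ B), ∃ (R : K) (r₀ r₁ : R ⟶ A), IsSubkernelPair h r₀ r₁

variable (K) in
/-- Every reflexive pair has a coinserter. -/
def HasReflexiveCoinserters : Prop :=
  ∀ ⦃X Y : K⦄ (f₀ f₁ : X ⟶ Y), IsReflexive f₀ f₁ → ∃ (C : K) (c : Y ⟶ C), IsCoinserter f₀ f₁ c

/-- A subregular epimorphism is a coinserter of a reflexive pair. -/
def IsSubregularEpi {Y C : K} (c : Y ⟶ C) : Prop :=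
  ∃ (X : K) (f₀ f₁ : X ⟶ Y), IsReflexive f₀ f₁ ∧ IsCoinserter f₀ f₁ c

/-- `ι m : G ⟶ X`, `m ∈ M`, exhibit `X` as the (conical) copower `M · G`. -/
structure IsCopower {M : Type u₀} {G X : K} (ι : M → (G ⟶ X)) : Prop where
  factors : ∀ ⦃Y : K⦄ (f : M → (G ⟶ Y)), ∃ h : X ⟶ Y, ∀ m, ι m ≫ h = f m
  reflects : ∀ ⦃Y : K⦄ (u₀ u₁ : X ⟶ Y), (∀ m, ι m ≫ u₀ ≤ ι m ≫ u₁) → u₀ ≤ u₁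

/-- `G` has copowers `M · G` for all (small) sets `M`. -/
def HasCopowers (G : K) : Prop :=
  ∀ M : Type v₁, ∃ (X : K) (ι : M → (G ⟶ X)), IsCopower ι

/-- `G` is abstractly finite: every morphism from `G` to a copower `M · G` factorizes through the
canonical morphism `M₀ · G ⟶ M · G` for some finite `M₀ ⊆ M`. -/
def IsAbstractlyFinite (G : K) : Prop :=
  ∀ (M : Type v₁) (X : K) (ι : M → (G ⟶ X)), IsCopower ι → ∀ f : G ⟶ X,
    ∃ (M₀ : Finset M) (X₀ : K) (ι₀ : {m // m ∈ M₀} → (G ⟶ X₀)) (u : X₀ ⟶ X) (g : G ⟶ X₀),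
      IsCopower ι₀ ∧ (∀ m : {m // m ∈ M₀}, ι₀ m ≫ u = ι m) ∧ g ≫ u = f

/-- `G` is a subregular projective: morphisms from `G` lift along subregular epimorphisms. -/
def IsSubregularProjective (G : K) : Prop :=
  ∀ ⦃A B : K⦄ (e : A ⟶ B), IsSubregularEpi e → ∀ g : G ⟶ B, ∃ g' : G ⟶ A, g' ≫ e = g

/-- `G` is a strong generator (in the enriched sense): its hom-functor into posets reflects
isomorphisms. That is, `h : A ⟶ B` is invertible whenever `h · (-) : K(G,A) → K(G,B)` is an
isomorphism of posets. -/
def IsStrongGenerator (G : K) : Prop :=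
  ∀ ⦃A B : K⦄ (h : A ⟶ B),
    Function.Surjective (fun g : G ⟶ A => g ≫ h) →
    (∀ g g' : G ⟶ A, g ≫ h ≤ g' ≫ h → g ≤ g') → IsIso h

/-- A subvarietal generator: a strong generator with copowers which is an abstractly finite
subregular projective. -/
structure IsSubvarietalGenerator (G : K) : Prop where
  strongGenerator : IsStrongGenerator G
  copowers : HasCopowers G
  abstractlyFinite : IsAbstractlyFinite G
  subregularProjective : IsSubregularProjective G

end Basic

section Weighted

/-- A functor between order-enriched categories is enriched iff it is locally monotone. -/
def LocallyMonotone {J : Type u₁} [Category.{v₁} J] [OrderEnriched J]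
    {K : Type u₂} [Category.{v₂} K] [OrderEnriched K] (D : J ⥤ K) : Prop :=
  ∀ ⦃i j : J⦄ (f f' : i ⟶ j), f ≤ f' → D.map f ≤ D.map f'

variable {J : Type u₀} [Category.{v₀} J] [OrderEnriched J]
variable {K : Type u₁} [Category.{v₁} K] [OrderEnriched K]

/-- A covariant weight: a functor to posets which is locally monotone (with respect to the pointwise
order of monotone maps). -/
def IsWeight (W : J ⥤ PartOrd.{v₂}) : Prop :=
  ∀ ⦃i j : J⦄ (f f' : i ⟶ j), f ≤ f' → ∀ x : W.obj i, W.map f x ≤ W.map f' x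

/-- A contravariant weight: a locally monotone functor from the opposite category to posets. -/
def IsOpWeight (W : Jᵒᵖ ⥤ PartOrd.{v₂}) : Prop :=
  ∀ ⦃i j : J⦄ (f f' : i ⟶ j), f ≤ f' → ∀ x : W.obj (op j), W.map f.op x ≤ W.map f'.op x

/-- Natural transformations from the weight `W` to `K(X, D -)` with monotone components. -/
def IsCone (W : J ⥤ PartOrd.{v₂}) (D : J ⥤ K) (X : K)
    (φ : ∀ j : J, W.obj j → (X ⟶ D.obj j)) : Prop :=
  (∀ j, Monotone (φ j)) ∧
    ∀ ⦃i j : J⦄ (f : i ⟶ j) (x : W.obj i), φ j (W.map f x) = φ i x ≫ D.map f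

/-- `L` with `π` is the limit of `D` weighted by `W`: composition with `π` is, for every `X`, an
isomorphism of posets from `K(X,L)` to the poset of natural transformations from `W` to
`K(X, D -)`. -/
structure IsWeightedLimit (W : J ⥤ PartOrd.{v₂}) (D : J ⥤ K) (L : K)
    (π : ∀ j : J, W.obj j → (L ⟶ D.obj j)) : Prop where
  cone : IsCone W D L π
  factors : ∀ (X : K) (φ : ∀ j : J, W.obj j → (X ⟶ D.obj j)), IsCone W D X φ →
    ∃ k : X ⟶ L, ∀ j x, k ≫ π j x = φ j x
  reflects : ∀ (X : K) (k k' : X ⟶ L), (∀ j x, k ≫ π j x ≤ k' ≫ π j x) → k ≤ k'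

/-- Natural transformations from the weight `W` to `K(D -, X)` with monotone components. -/
def IsCocone (W : Jᵒᵖ ⥤ PartOrd.{v₂}) (D : J ⥤ K) (X : K)
    (φ : ∀ j : J, W.obj (op j) → (D.obj j ⟶ X)) : Prop :=
  (∀ j, Monotone (φ j)) ∧
    ∀ ⦃i j : J⦄ (f : i ⟶ j) (x : W.obj (op j)), φ i (W.map f.op x) = D.map f ≫ φ j x

/-- `C` with `ι` is the colimit of `D` weighted by `W`: composition with `ι` is, for every `X`, an
isomorphism of posets from `K(C,X)` to the poset of natural transformations from `W` to
`K(D -, X)`. -/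
structure IsWeightedColimit (W : Jᵒᵖ ⥤ PartOrd.{v₂}) (D : J ⥤ K) (C : K)
    (ι : ∀ j : J, W.obj (op j) → (D.obj j ⟶ C)) : Prop where
  cocone : IsCocone W D C ι
  factors : ∀ (X : K) (φ : ∀ j : J, W.obj (op j) → (D.obj j ⟶ X)), IsCocone W D X φ →
    ∃ k : C ⟶ X, ∀ j x, ι j x ≫ k = φ j x
  reflects : ∀ (X : K) (k k' : C ⟶ X), (∀ j x, ι j x ≫ k ≤ ι j x ≫ k') → k ≤ k'

variable (K)

/-- The order-enriched category `K` is complete: it has all small weighted limits. -/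
def IsComplete : Prop :=
  ∀ (J : Type v₁) [SmallCategory J] [OrderEnriched J] (W : J ⥤ PartOrd.{v₁}) (D : J ⥤ K),
    IsWeight W → LocallyMonotone D →
      ∃ (L : K) (π : ∀ j : J, W.obj j → (L ⟶ D.obj j)), IsWeightedLimit W D L π

/-- The order-enriched category `K` is cocomplete: it has all small weighted colimits. -/
def IsCocomplete : Prop :=
  ∀ (J : Type v₁) [SmallCategory J] [OrderEnriched J] (W : Jᵒᵖ ⥤ PartOrd.{v₁}) (D : J ⥤ K),
    IsOpWeight W → LocallyMonotone D →
      ∃ (C : K) (ι : ∀ j : J, W.obj (op j) → (D.obj j ⟶ C)), IsWeightedColimit W D C ι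

end Weighted

end OrderNotions

/-! Both halves rest on one idea: `G` presents `K` by generators and relations, so limits and
colimits are computed on morphisms out of `G` and realized as quotients of free objects.

Enriched case. The adjunction `P ⊗ G ⊣ K(G,-)` gives a monad `T P = K(G, P ⊗ G)` on `V`, and each
`K(G,X)` carries the action `K(G, ε)` of `T`, where `ε : K(G,X) ⊗ G ⟶ X` is the counit. Density
makes `K` fully faithful over these actions: `exists_hom_of_isDense` and `hom_ext_of_isDense` say
that `Z`-parametrized homomorphisms `K(G,X) ⊗ Z ⟶ K(G,Y)` are precisely the generalized elements of
`K(X,Y)`. For a limit, the object `P` of cones over `K(G, D -)` acquires an action of `T`, and the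
reflexive coequalizer that Beck's theorem associates with it has `P` as its `K(G,-)`. For a colimit,
`∐ K(G, D j) ⊗ W j ⊗ G` is divided by the relations forcing the coprojections to be homomorphisms
and natural.

Order-enriched case. Projectivity and strong generation make every object the coinserter of a
reflexive pair on a copower of `G` (`exists_presentation`). A limit is a quotient of the copower of
`G` indexed by all cones on `G`; a colimit is a quotient of the copower indexed by the elements `G ⟶
D j` weighted by `W j`. The relation compares morphisms from `G` to the copower by testing them on
cone projections, respectively on all cocones. -/

namespace OrderNotions

/-! ### Order-enriched categories with a subvarietal generator. -/

section Order

variable {K : Type u₁} [Category.{v₁} K] [OrderEnriched K]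

theorem comp_mono_left {X Y Z : K} {f f' : X ⟶ Y} (h : f ≤ f') (g : Y ⟶ Z) : f ≫ g ≤ f' ≫ g :=
  OrderEnriched.comp_le_comp h le_rfl

theorem comp_mono_right {X Y Z : K} (f : X ⟶ Y) {g g' : Y ⟶ Z} (h : g ≤ g') : f ≫ g ≤ f ≫ g' :=
  OrderEnriched.comp_le_comp le_rfl h

theorem IsCopower.hom_ext {M : Type u₀} {G X Y : K} {ι : M → (G ⟶ X)} (h : IsCopower ι)
    {u₀ u₁ : X ⟶ Y} (hu : ∀ m, ι m ≫ u₀ = ι m ≫ u₁) : u₀ = u₁ :=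
  le_antisymm (h.reflects _ _ fun m => (hu m).le) (h.reflects _ _ fun m => (hu m).ge)

theorem IsSubkernelPair.isReflexive {R A B : K} {h : A ⟶ B} {r₀ r₁ : R ⟶ A}
    (hr : IsSubkernelPair h r₀ r₁) : IsReflexive r₀ r₁ :=
  hr.factors (𝟙 A) (𝟙 A) le_rfl

/-- A subregular projective strong generator presents every object: a morphism `c` through which
all morphisms from `G` factorize is the coinserter of its subkernel pair. -/
theorem isCoinserter_of_isSubkernelPair (hcoins : HasReflexiveCoinserters K) {G : K}
    (hgen : IsStrongGenerator G) (hproj : IsSubregularProjective G)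
    {F X R : K} {c : F ⟶ X} (hc : ∀ g : G ⟶ X, ∃ g' : G ⟶ F, g' ≫ c = g)
    {r₀ r₁ : R ⟶ F} (hr : IsSubkernelPair c r₀ r₁) : IsCoinserter r₀ r₁ c := by
  obtain ⟨C, e, he⟩ := hcoins r₀ r₁ hr.isReflexive
  obtain ⟨m, hm⟩ := he.factors c hr.le
  have hlift := hproj e ⟨R, r₀, r₁, hr.isReflexive, he⟩
  -- Lifts `t`, `t'` to `F` of two morphisms `G ⟶ C` that become ordered in `X` form a pair ordered
  -- by `c`. This pair factors through the subkernel pair, so `e` already orders it; hence `m`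
  -- reflects the order.
  have : IsIso m := by
    refine hgen m (fun g => ?_) (fun g g' hgg => ?_)
    · obtain ⟨t, rfl⟩ := hc g
      exact ⟨t ≫ e, by simp [hm]⟩
    · obtain ⟨t, rfl⟩ := hlift g
      obtain ⟨t', rfl⟩ := hlift g'
      simp only [Category.assoc, hm] at hgg
      obtain ⟨s, rfl, rfl⟩ := hr.factors t t' hgg
      simpa using comp_mono_right s he.le
  refine ⟨hr.le, fun C' c' hc' => ?_, fun U u₀ u₁ hu => ?_⟩
  · obtain ⟨k, hk⟩ := he.factors c' hc'
    exact ⟨inv m ≫ k, by rw [← hm]; simp [hk]⟩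
  · have h1 : m ≫ u₀ ≤ m ≫ u₁ := he.reflects _ _ (by simpa [← Category.assoc, hm] using hu)
    simpa using comp_mono_right (inv m) h1

/-- The canonical presentation of an object by a copower of a subvarietal generator. -/
theorem IsSubvarietalGenerator.exists_presentation (hker : HasSubkernelPairs K)
    (hcoins : HasReflexiveCoinserters K) {G : K} (hG : IsSubvarietalGenerator G) (X : K) :
    ∃ (F R : K) (ι : (G ⟶ X) → (G ⟶ F)) (c : F ⟶ X) (r₀ r₁ : R ⟶ F),
      IsCopower ι ∧ (∀ g, ι g ≫ c = g) ∧ IsCoinserter r₀ r₁ c := by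
  obtain ⟨F, ι, hι⟩ := hG.copowers (G ⟶ X)
  obtain ⟨c, hc⟩ := hι.factors (fun g => g)
  obtain ⟨R, r₀, r₁, hr⟩ := hker c
  exact ⟨F, R, ι, c, r₀, r₁, hι, hc, isCoinserter_of_isSubkernelPair hcoins hG.strongGenerator
    hG.subregularProjective (fun g => ⟨ι g, hc g⟩) hr⟩

/-- The coprojections followed by the presentation `c` are exactly the morphisms `G ⟶ X`, and both
copowers and coinserters reflect the order. -/
theorem IsSubvarietalGenerator.le_of_forall (hker : HasSubkernelPairs K)
    (hcoins : HasReflexiveCoinserters K) {G : K} (hG : IsSubvarietalGenerator G) {X Y : K}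
    {h h' : X ⟶ Y} (H : ∀ g : G ⟶ X, g ≫ h ≤ g ≫ h') : h ≤ h' := by
  obtain ⟨F, R, ι, c, r₀, r₁, hι, hc, hcc⟩ := hG.exists_presentation hker hcoins X
  refine hcc.reflects _ _ (hι.reflects _ _ fun g => ?_)
  simpa [← Category.assoc, hc] using H g

/-- The quotient of a copower `F` of `G` by a reflexive relation on the morphisms `G ⟶ F`. -/
theorem IsSubvarietalGenerator.exists_quotient (hcoins : HasReflexiveCoinserters K) {G : K}
    (hG : IsSubvarietalGenerator G) {M : Type v₁} {F : K} {ι : M → (G ⟶ F)} (hι : IsCopower ι)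
    (r : (G ⟶ F) → (G ⟶ F) → Prop) (hr : ∀ m, r (ι m) (ι m)) :
    ∃ (Q : K) (q : F ⟶ Q), (∀ t t', r t t' → t ≫ q ≤ t' ≫ q) ∧
      (∀ ⦃C : K⦄ (f : F ⟶ C), (∀ t t', r t t' → t ≫ f ≤ t' ≫ f) → ∃ h : Q ⟶ C, q ≫ h = f) ∧
      (∀ ⦃U : K⦄ (u₀ u₁ : Q ⟶ U), q ≫ u₀ ≤ q ≫ u₁ → u₀ ≤ u₁) ∧
      (∀ g : G ⟶ Q, ∃ g' : G ⟶ F, g' ≫ q = g) := by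
  obtain ⟨S, σ, hσ⟩ := hG.copowers {p : (G ⟶ F) × (G ⟶ F) // r p.1 p.2}
  obtain ⟨f₀, hf₀⟩ := hσ.factors fun p => p.1.1
  obtain ⟨f₁, hf₁⟩ := hσ.factors fun p => p.1.2
  -- A common section only has to be given on the coprojections of `F`, so reflexivity of `r` is
  -- needed there alone.
  obtain ⟨d, hd⟩ := hι.factors fun m => σ ⟨(ι m, ι m), hr m⟩
  have hrefl : IsReflexive f₀ f₁ :=
    ⟨d, hι.hom_ext fun m => by rw [← Category.assoc, hd, hf₀, Category.comp_id],
      hι.hom_ext fun m => by rw [← Category.assoc, hd, hf₁, Category.comp_id]⟩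
  obtain ⟨Q, q, hq⟩ := hcoins f₀ f₁ hrefl
  refine ⟨Q, q, fun t t' h => ?_, fun C f hf => hq.factors f (hσ.reflects _ _ fun p => ?_),
    hq.reflects, hG.subregularProjective q ⟨S, f₀, f₁, hrefl, hq⟩⟩
  · have := comp_mono_right (σ ⟨(t, t'), h⟩) hq.le
    rwa [← Category.assoc, ← Category.assoc, hf₀, hf₁] at this
  · rw [← Category.assoc, ← Category.assoc, hf₀, hf₁]
    exact hf _ _ p.2

/-- The quotient `Q` is designed so that `K(G,Q)` is the poset of cones on `G`: each cone is hit by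
its coprojection, and the relation makes the projections jointly reflect the order. Presentations by
copowers of `G` carry this over to arbitrary `X`. -/
theorem IsSubvarietalGenerator.isComplete (hker : HasSubkernelPairs K)
    (hcoins : HasReflexiveCoinserters K) {G : K} (hG : IsSubvarietalGenerator G) :
    IsComplete K := by
  intro J _ _ W D hW hD
  obtain ⟨F, η, hη⟩ := hG.copowers {φ : ∀ j : J, W.obj j → (G ⟶ D.obj j) // IsCone W D G φ}
  choose p hp using fun (j : J) (w : W.obj j) => hη.factors fun φ => φ.1 j w
  obtain ⟨Q, q, hq, hfac, href, hlift⟩ := hG.exists_quotient hcoins hη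
    (fun t t' => ∀ j w, t ≫ p j w ≤ t' ≫ p j w) (fun _ _ _ => le_rfl)
  choose π hπ using fun (j : J) (w : W.obj j) => hfac (p j w) (fun t t' h => h j w)
  have key (g g' : G ⟶ Q) (h : ∀ j w, g ≫ π j w ≤ g' ≫ π j w) : g ≤ g' := by
    obtain ⟨t, rfl⟩ := hlift g
    obtain ⟨t', rfl⟩ := hlift g'
    exact hq _ _ fun j w => by simpa [hπ] using h j w
  have hreflects (X : K) (k k' : X ⟶ Q) (h : ∀ j x, k ≫ π j x ≤ k' ≫ π j x) : k ≤ k' :=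
    hG.le_of_forall hker hcoins fun g => key _ _ fun j w => by
      simpa using comp_mono_right g (h j w)
  refine ⟨Q, π, ⟨fun j w w' h => href _ _ ?_, fun i j f w => ?_⟩, fun X φ hφ => ?_, hreflects⟩
  · rw [hπ, hπ]
    exact hη.reflects _ _ fun φ => by rw [hp, hp]; exact φ.2.1 j h
  · have h : q ≫ π j (W.map f w) = q ≫ π i w ≫ D.map f := by
      rw [hπ, ← Category.assoc, hπ]
      exact hη.hom_ext fun φ => by rw [hp, ← Category.assoc, hp, φ.2.2]
    exact le_antisymm (href _ _ h.le) (href _ _ h.ge)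
  -- Restricting `φ` along each `g : G ⟶ X` gives a cone on `G`, hence a morphism `G ⟶ Q`. Together
  -- these define `k` on the copower presenting `X`; `k` descends to `X` because the projections of
  -- `Q` jointly reflect the order.
  · obtain ⟨FX, R, ι, c, r₀, r₁, hι, hc, hcc⟩ := hG.exists_presentation hker hcoins X
    obtain ⟨k, hk⟩ := hι.factors fun g : G ⟶ X => η ⟨fun j w => g ≫ φ j w,
      fun j w w' h => comp_mono_right g (hφ.1 j h), fun i j f w => by simp [hφ.2]⟩ ≫ q
    have hkπ (j : J) (w : W.obj j) : k ≫ π j w = c ≫ φ j w :=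
      hι.hom_ext fun g => by
        rw [← Category.assoc, hk, Category.assoc, hπ, hp, ← Category.assoc, hc]
    obtain ⟨l, hl⟩ := hcc.factors k (hreflects _ _ _ fun j w => by
      simpa [hkπ] using comp_mono_left hcc.le (φ j w))
    refine ⟨l, fun j w => ?_⟩
    have h : c ≫ l ≫ π j w = c ≫ φ j w := by rw [← Category.assoc, hl, hkπ]
    exact le_antisymm (hcc.reflects _ _ h.le) (hcc.reflects _ _ h.ge)

theorem IsSubvarietalGenerator.isCocomplete (hker : HasSubkernelPairs K)
    (hcoins : HasReflexiveCoinserters K) {G : K} (hG : IsSubvarietalGenerator G) :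
    IsCocomplete K := by
  intro J _ _ W D hW hD
  obtain ⟨F, η, hη⟩ := hG.copowers (Σ j : J, W.obj (op j) × (G ⟶ D.obj j))
  choose ext hext using fun (X : K) (φ : ∀ j : J, W.obj (op j) → (D.obj j ⟶ X)) =>
    hη.factors fun m => m.2.2 ≫ φ m.1 m.2.1
  -- Testing against cocones with arbitrary vertex causes no size problem: the result is still a
  -- relation on the small set of morphisms `G ⟶ F`.
  obtain ⟨Q, q, hq, hfac, href, -⟩ := hG.exists_quotient hcoins hη
    (fun t t' => ∀ (X : K) (φ : ∀ j : J, W.obj (op j) → (D.obj j ⟶ X)), IsCocone W D X φ →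
      t ≫ ext X φ ≤ t' ≫ ext X φ) (fun _ _ _ _ => le_rfl)
  choose FX R ι c r₀ r₁ hι hc hcc using hG.exists_presentation hker hcoins
  choose x hx using fun (j : J) (w : W.obj (op j)) =>
    (hι (D.obj j)).factors fun g => η ⟨j, w, g⟩
  have hxext (X : K) (φ : ∀ j : J, W.obj (op j) → (D.obj j ⟶ X)) (j : J) (w : W.obj (op j)) :
      x j w ≫ ext X φ = c (D.obj j) ≫ φ j w :=
    (hι _).hom_ext fun g => by
      rw [← Category.assoc, hx, hext, ← Category.assoc, hc]
  -- The map `x j w ≫ q` respects the presentation of `D.obj j` because, tested on a cocone `φ`, `x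
  -- j w` becomes `c ≫ φ j w`.
  choose κ hκ using fun (j : J) (w : W.obj (op j)) =>
    (hcc (D.obj j)).factors (x j w ≫ q) (hG.le_of_forall hker hcoins fun t => by
      simpa using hq (t ≫ r₀ _ ≫ x j w) (t ≫ r₁ _ ≫ x j w) fun X φ _ => by
        simpa [hxext] using comp_mono_right t (comp_mono_left (hcc (D.obj j)).le (φ j w)))
  have hηκ (j : J) (w : W.obj (op j)) (g : G ⟶ D.obj j) : g ≫ κ j w = η ⟨j, w, g⟩ ≫ q := by
    rw [← hx, Category.assoc, ← hκ, ← Category.assoc, hc]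
  refine ⟨Q, κ, ⟨fun j w w' h => ?_, fun i j f w => ?_⟩, fun X φ hφ => ?_, fun X k k' h => ?_⟩
  · refine hG.le_of_forall hker hcoins fun g => ?_
    rw [hηκ, hηκ]
    exact hq _ _ fun X φ hφ => by rw [hext, hext]; exact comp_mono_right g (hφ.1 j h)
  · have h (g : G ⟶ D.obj i) : g ≫ κ i (W.map f.op w) = g ≫ D.map f ≫ κ j w := by
      rw [← Category.assoc, hηκ, hηκ]
      have h' (X : K) (φ : ∀ j : J, W.obj (op j) → (D.obj j ⟶ X)) (hφ : IsCocone W D X φ) :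
          η ⟨i, W.map f.op w, g⟩ ≫ ext X φ = η ⟨j, w, g ≫ D.map f⟩ ≫ ext X φ := by
        rw [hext, hext, hφ.2, Category.assoc]
      exact le_antisymm (hq _ _ fun X φ hφ => (h' X φ hφ).le)
        (hq _ _ fun X φ hφ => (h' X φ hφ).ge)
    exact le_antisymm (hG.le_of_forall hker hcoins fun g => (h g).le)
      (hG.le_of_forall hker hcoins fun g => (h g).ge)
  · obtain ⟨k, hk⟩ := hfac (ext X φ) fun t t' h => h X φ hφ
    refine ⟨k, fun j w => ?_⟩
    have h : c _ ≫ κ j w ≫ k = c _ ≫ φ j w := by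
      rw [← Category.assoc, hκ, Category.assoc, hk, hxext]
    exact le_antisymm ((hcc _).reflects _ _ h.le) ((hcc _).reflects _ _ h.ge)
  · refine href _ _ (hη.reflects _ _ fun m => ?_)
    rw [← Category.assoc, ← Category.assoc, ← hηκ, Category.assoc, Category.assoc]
    exact comp_mono_right _ (h _ _)

end Order

end OrderNotions

namespace EnrichedNotions

/-! ### Calculus of generalized elements of hom-objects. -/

section GeneralizedElements

variable {V : Type u₁} [Category.{v₁} V] [MonoidalCategory V]

section EnrichedCategory

variable {K : Type u₂} [EnrichedCategory V K]

/-- Composition of generalized elements of hom-objects. -/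
def gcomp {A B C : K} {Z Z' : V} (f : Z ⟶ (A ⟶[V] B)) (g : Z' ⟶ (B ⟶[V] C)) :
    Z ⊗ Z' ⟶ (A ⟶[V] C) :=
  (f ⊗ₘ g) ≫ eComp V A B C

local infixr:85 " ⋄ " => gcomp

theorem comp_gcomp {A B C : K} {S Z Z' : V} (a : S ⟶ Z) (f : Z ⟶ (A ⟶[V] B))
    (g : Z' ⟶ (B ⟶[V] C)) : (a ≫ f) ⋄ g = a ▷ Z' ≫ f ⋄ g := by
  simp [gcomp, MonoidalCategory.tensorHom_def]

theorem gcomp_comp {A B C : K} {S Z Z' : V} (a : S ⟶ Z') (f : Z ⟶ (A ⟶[V] B))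
    (g : Z' ⟶ (B ⟶[V] C)) : f ⋄ (a ≫ g) = Z ◁ a ≫ f ⋄ g := by
  simp [gcomp, tensorHom_def']

theorem gcomp_eq_left {A B C : K} {Z Z' : V} (f : Z ⟶ (A ⟶[V] B)) (g : Z' ⟶ (B ⟶[V] C)) :
    f ⋄ g = f ▷ Z' ≫ 𝟙 (A ⟶[V] B) ⋄ g := by
  rw [← comp_gcomp, Category.comp_id]

theorem id_gcomp {A B C : K} {Z : V} (g : Z ⟶ (B ⟶[V] C)) :
    𝟙 (A ⟶[V] B) ⋄ g = (A ⟶[V] B) ◁ g ≫ eComp V A B C := by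
  simp [gcomp]

theorem id_gcomp_id (A B C : K) : 𝟙 (A ⟶[V] B) ⋄ 𝟙 (B ⟶[V] C) = eComp V A B C := by
  simp [gcomp]

theorem gcomp_assoc {A B C D : K} {Z Z' Z'' : V} (f : Z ⟶ (A ⟶[V] B)) (g : Z' ⟶ (B ⟶[V] C))
    (h : Z'' ⟶ (C ⟶[V] D)) : (f ⋄ g) ⋄ h = (α_ Z Z' Z'').hom ≫ f ⋄ g ⋄ h := by
  have h1 : ((f ⊗ₘ g) ≫ eComp V A B C) ⊗ₘ h =
      ((f ⊗ₘ g) ⊗ₘ h) ≫ eComp V A B C ▷ (C ⟶[V] D) := by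
    rw [← tensorHom_id, tensorHom_comp_tensorHom, Category.comp_id]
  have h2 : f ⊗ₘ ((g ⊗ₘ h) ≫ eComp V B C D) =
      (f ⊗ₘ (g ⊗ₘ h)) ≫ (A ⟶[V] B) ◁ eComp V B C D := by
    simp [MonoidalCategory.tensorHom_def]
  rw [gcomp, gcomp, gcomp, gcomp, h1, h2, Category.assoc, Category.assoc, ← e_assoc',
    ← associator_naturality_assoc]

theorem gcomp_assoc' {A B C D : K} {Z Z' Z'' : V} (f : Z ⟶ (A ⟶[V] B)) (g : Z' ⟶ (B ⟶[V] C))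
    (h : Z'' ⟶ (C ⟶[V] D)) : f ⋄ g ⋄ h = (α_ Z Z' Z'').inv ≫ (f ⋄ g) ⋄ h := by
  rw [gcomp_assoc, Iso.inv_hom_id_assoc]

theorem eId_gcomp {A B : K} {Z : V} (g : Z ⟶ (A ⟶[V] B)) :
    eId V A ⋄ g = (λ_ Z).hom ≫ g := by
  rw [← Iso.inv_comp_eq, gcomp, tensorHom_def', Category.assoc, ← Category.comp_id g]
  simp only [Category.comp_id]
  rw [← leftUnitor_inv_naturality_assoc, e_id_comp, Category.comp_id]

theorem gcomp_eId {A B : K} {Z : V} (g : Z ⟶ (A ⟶[V] B)) :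
    g ⋄ eId V B = (ρ_ Z).hom ≫ g := by
  rw [← Iso.inv_comp_eq, gcomp, MonoidalCategory.tensorHom_def, Category.assoc,
    ← rightUnitor_inv_naturality_assoc, e_comp_id, Category.comp_id]

end EnrichedCategory

local infixr:85 " ⋄ " => gcomp

variable {K : Type u₂} [Category.{v₂} K] [EnrichedOrdinaryCategory V K]

theorem gcomp_eHomEquiv {A B C : K} {Z : V} (f : Z ⟶ (A ⟶[V] B)) (c : B ⟶ C) :
    f ⋄ eHomEquiv V c = (ρ_ Z).hom ≫ f ≫ eHomWhiskerLeft V A c := by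
  rw [← Iso.inv_comp_eq, gcomp, MonoidalCategory.tensorHom_def, Category.assoc,
    ← rightUnitor_inv_naturality_assoc, eHomWhiskerLeft]

theorem eHomEquiv_gcomp {A B C : K} {Z : V} (c : A ⟶ B) (g : Z ⟶ (B ⟶[V] C)) :
    eHomEquiv V c ⋄ g = (λ_ Z).hom ≫ g ≫ eHomWhiskerRight V c C := by
  rw [← Iso.inv_comp_eq, gcomp, tensorHom_def', Category.assoc,
    ← leftUnitor_inv_naturality_assoc, eHomWhiskerRight]

theorem gcomp_whiskerLeft {A B C C' : K} {Z Z' : V} (f : Z ⟶ (A ⟶[V] B)) (g : Z' ⟶ (B ⟶[V] C))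
    (c : C ⟶ C') : f ⋄ (g ≫ eHomWhiskerLeft V B c) = f ⋄ g ≫ eHomWhiskerLeft V A c := by
  simp [gcomp, MonoidalCategory.tensorHom_def, eComp_eHomWhiskerLeft]

/-- This is associativity for `f`, the element of `B ⟶[V] B'` named by `c`, and `g`; the unitors
cancel by the triangle identity. -/
theorem whiskerLeft_gcomp {A B B' C : K} {Z Z' : V} (f : Z ⟶ (A ⟶[V] B)) (c : B ⟶ B')
    (g : Z' ⟶ (B' ⟶[V] C)) :
    (f ≫ eHomWhiskerLeft V A c) ⋄ g = f ⋄ (g ≫ eHomWhiskerRight V c C) := by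
  have h := gcomp_assoc f (eHomEquiv V c) g
  rw [gcomp_eHomEquiv, eHomEquiv_gcomp, comp_gcomp, gcomp_comp, triangle_assoc] at h
  exact (cancel_epi _).1 h

end GeneralizedElements

/-! ### Tensors of `G` and their reflexive quotients. -/

section Tensors

variable {V : Type u₁} [Category.{v₁} V] [MonoidalCategory V]
variable {K : Type u₂} [Category.{v₂} K] [EnrichedOrdinaryCategory V K] {G : K}

local infixr:85 " ⋄ " => gcomp

namespace HasTensors

/-- A chosen tensor `P ⊗ G`. -/
noncomputable def obj (hT : HasTensors V G) (P : V) : K := (hT P).choose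

/-- The unit of a chosen tensor. -/
noncomputable def unit (hT : HasTensors V G) (P : V) : P ⟶ (G ⟶[V] hT.obj P) :=
  (hT P).choose_spec.choose

theorem isTensor (hT : HasTensors V G) (P : V) : IsTensor V (hT.unit P) :=
  (hT P).choose_spec.choose_spec

variable (hT : HasTensors V G) {P : V} {Y : K}

/-- The transpose of a morphism along the universal property of a tensor. -/
noncomputable def lift {Z : V} (h : P ⊗ Z ⟶ (G ⟶[V] Y)) : Z ⟶ (hT.obj P ⟶[V] Y) :=
  (hT.isTensor P Y Z h).choose

theorem unit_gcomp_lift {Z : V} (h : P ⊗ Z ⟶ (G ⟶[V] Y)) : hT.unit P ⋄ hT.lift h = h :=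
  (hT.isTensor P Y Z h).choose_spec.1

theorem ext {Z : V} {k k' : Z ⟶ (hT.obj P ⟶[V] Y)} (h : hT.unit P ⋄ k = hT.unit P ⋄ k') :
    k = k' :=
  (hT.isTensor P Y Z (hT.unit P ⋄ k')).unique h rfl

/-- The morphism out of a tensor induced by a morphism into a hom-object. -/
noncomputable def desc (h : P ⟶ (G ⟶[V] Y)) : hT.obj P ⟶ Y :=
  (eHomEquiv V).symm (hT.lift ((ρ_ P).hom ≫ h))

theorem unit_desc (h : P ⟶ (G ⟶[V] Y)) : hT.unit P ≫ eHomWhiskerLeft V G (hT.desc h) = h := by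
  have := gcomp_eHomEquiv (hT.unit P) (hT.desc h)
  rw [desc, Equiv.apply_symm_apply, unit_gcomp_lift] at this
  exact ((cancel_epi _).1 this).symm

theorem desc_ext {f g : hT.obj P ⟶ Y}
    (h : hT.unit P ≫ eHomWhiskerLeft V G f = hT.unit P ≫ eHomWhiskerLeft V G g) : f = g := by
  refine (eHomEquiv V).injective (hT.ext ?_)
  rw [gcomp_eHomEquiv, gcomp_eHomEquiv, h]

/-- The counit `K(G,X) ⊗ G ⟶ X`. -/
noncomputable def counit (X : K) : hT.obj (G ⟶[V] X) ⟶ X := hT.desc (𝟙 _)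

theorem unit_counit (X : K) :
    hT.unit (G ⟶[V] X) ≫ eHomWhiskerLeft V G (hT.counit X) = 𝟙 (G ⟶[V] X) :=
  hT.unit_desc _

theorem unit_gcomp_whiskerRight_counit {X : K} {Z : V} (k : Z ⟶ (X ⟶[V] Y)) :
    hT.unit (G ⟶[V] X) ⋄ (k ≫ eHomWhiskerRight V (hT.counit X) Y) = 𝟙 (G ⟶[V] X) ⋄ k := by
  rw [← whiskerLeft_gcomp, unit_counit]

/-- The quotient of a tensor `P ⊗ G` by a reflexive pair of generalized elements of
`K(G, P ⊗ G)`. -/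
theorem exists_quotient (hcoeq : HasReflexiveCoequalizers V K) {R : V}
    (a b : R ⟶ (G ⟶[V] hT.obj P)) (s : P ⟶ R) (ha : s ≫ a = hT.unit P)
    (hb : s ≫ b = hT.unit P) :
    ∃ (Q : K) (q : hT.obj P ⟶ Q), a ≫ eHomWhiskerLeft V G q = b ≫ eHomWhiskerLeft V G q ∧
      ∀ (Y : K) (Z : V) (h : Z ⟶ (hT.obj P ⟶[V] Y)), a ⋄ h = b ⋄ h →
        ∃! k : Z ⟶ (Q ⟶[V] Y), k ≫ eHomWhiskerRight V q Y = h := by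
  -- The pair is the transpose `R ⊗ G ⇉ P ⊗ G` of `a` and `b`; its common section is `s ⊗ G`.
  obtain ⟨Q, q, hq, hu⟩ := hcoeq (hT.desc a) (hT.desc b) ⟨hT.desc (s ≫ hT.unit R),
    hT.desc_ext (by simp [← Category.assoc, unit_desc]; simp [unit_desc, ha]),
    hT.desc_ext (by simp [← Category.assoc, unit_desc]; simp [unit_desc, hb])⟩
  refine ⟨Q, q, ?_, fun Y Z h hh => hu Y Z h (hT.ext ?_)⟩
  · have := congrArg (fun t => hT.unit R ≫ eHomWhiskerLeft V G t) hq
    simpa [← Category.assoc, unit_desc] using this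
  · rw [← whiskerLeft_gcomp, ← whiskerLeft_gcomp, unit_desc, unit_desc, hh]

end HasTensors

end Tensors

/-! ### Consequences of density of the finite copowers. -/

section Density

variable {V : Type u₁} [Category.{v₁} V] [MonoidalCategory V]
variable {K : Type u₂} [Category.{v₂} K] [EnrichedOrdinaryCategory V K] {G : K}

local infixr:85 " ⋄ " => gcomp

variable (V G) in
theorem isFiniteCopower_self : IsFiniteCopower V G G := by
  refine ⟨1, fun _ => 𝟙 G, fun Y Z h => ⟨h 0, fun m => ?_, fun k hk => ?_⟩⟩
  · rw [eHomWhiskerRight_id, Category.comp_id, Subsingleton.elim m 0]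
  · simpa using hk 0

theorem IsFiniteCopower.hom_ext {A Y : K} (hA : IsFiniteCopower V G A) {Z : V}
    {p q : Z ⟶ (A ⟶[V] Y)} (h : 𝟙 (G ⟶[V] A) ⋄ p = 𝟙 (G ⟶[V] A) ⋄ q) : p = q := by
  obtain ⟨n, ι, hι⟩ := hA
  refine (hι Y Z fun m => q ≫ eHomWhiskerRight V (ι m) Y).unique (fun m => ?_) (fun m => rfl)
  have h1 : eHomEquiv V (ι m) ⋄ p = eHomEquiv V (ι m) ⋄ q := by
    rw [gcomp_eq_left, h, ← gcomp_eq_left]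
  rw [eHomEquiv_gcomp, eHomEquiv_gcomp] at h1
  exact (cancel_epi _).1 h1

/-- The unit splits `K(G, ε)`, and `K(A,-)` is a power of `K(G,-)`, so a tuple of units splits `K(A,
ε)`. -/
theorem IsFiniteCopower.exists_section {A X : K} (hA : IsFiniteCopower V G A)
    (hT : HasTensors V G) : ∃ v : (A ⟶[V] X) ⟶ (A ⟶[V] hT.obj (G ⟶[V] X)),
      v ≫ eHomWhiskerLeft V A (hT.counit X) = 𝟙 _ := by
  obtain ⟨n, ι, hι⟩ := hA
  obtain ⟨v, hv, -⟩ := hι (hT.obj (G ⟶[V] X)) (A ⟶[V] X)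
    fun m => eHomWhiskerRight V (ι m) X ≫ hT.unit _
  refine ⟨v, (hι X _ fun m => eHomWhiskerRight V (ι m) X).unique (fun m => ?_) (fun m => ?_)⟩
  · rw [Category.assoc, eHom_whisker_exchange, reassoc_of% hv m, hT.unit_counit, Category.comp_id]
  · simp

theorem hom_ext_of_isDense (hd : IsDense V (IsFiniteCopower V G)) {X Y : K} {Z : V}
    {k k' : Z ⟶ (X ⟶[V] Y)} (h : 𝟙 (G ⟶[V] X) ⋄ k = 𝟙 (G ⟶[V] X) ⋄ k') : k = k' := by
  have hA (A : K) (hA : IsFiniteCopower V G A) :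
      𝟙 (A ⟶[V] X) ⋄ k = 𝟙 (A ⟶[V] X) ⋄ k' := by
    refine hA.hom_ext ?_
    rw [gcomp_assoc', gcomp_assoc', gcomp_eq_left (_ ⋄ _), h, ← gcomp_eq_left]
  refine (hd X Y Z (fun A _ => 𝟙 (A ⟶[V] X) ⋄ k) fun A B _ _ => ?_).unique
    (fun A _ => (id_gcomp k).symm) fun A hA' => ?_
  · rw [← id_gcomp, ← gcomp_assoc, id_gcomp_id, gcomp_eq_left (eComp V B A X)]
  · rw [hA A hA', id_gcomp]

/-- The hypothesis says that `φ` is a homomorphism for the actions `K(G, ε)`. For a finite copower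
`A`, lifting along a section of `K(A, ε)` and applying `hT.lift φ` extends `φ` to `K(A,X) ⊗ Z ⟶
K(A,Y)`. By the hypothesis this restricts to `φ` along every `G ⟶ A`, which yields naturality, and
density applies. -/
theorem exists_hom_of_isDense (hd : IsDense V (IsFiniteCopower V G)) (hT : HasTensors V G)
    {X Y : K} {Z : V} (φ : (G ⟶[V] X) ⊗ Z ⟶ (G ⟶[V] Y))
    (hφ : 𝟙 (G ⟶[V] hT.obj (G ⟶[V] X)) ⋄ hT.lift φ =
      eHomWhiskerLeft V G (hT.counit X) ▷ Z ≫ φ) :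
    ∃ k : Z ⟶ (X ⟶[V] Y), 𝟙 (G ⟶[V] X) ⋄ k = φ := by
  have hv (A : K) (v : (A ⟶[V] X) ⟶ (A ⟶[V] hT.obj (G ⟶[V] X)))
      (hv : v ≫ eHomWhiskerLeft V A (hT.counit X) = 𝟙 _) :
      𝟙 (G ⟶[V] A) ⋄ v ⋄ hT.lift φ =
        (α_ (G ⟶[V] A) (A ⟶[V] X) Z).inv ≫ eComp V G A X ▷ Z ≫ φ := by
    rw [gcomp_assoc', gcomp_eq_left (_ ⋄ _), hφ, ← comp_whiskerRight_assoc,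
      ← gcomp_whiskerLeft, hv, id_gcomp_id]
  choose v hv' using fun (A : K) (hA : IsFiniteCopower V G A) =>
    hA.exists_section (X := X) hT
  obtain ⟨k, hk, -⟩ := hd X Y Z (fun A hA => v A hA ⋄ hT.lift φ) fun A B hA hB => by
    refine hB.hom_ext ?_
    rw [← id_gcomp, gcomp_comp, hv B _ (hv' B hB), gcomp_comp, gcomp_assoc',
      gcomp_eq_left (_ ⋄ _), hv A _ (hv' A hA), id_gcomp_id]
    simp only [← comp_whiskerRight_assoc, ← e_assoc', associator_inv_naturality_left_assoc]
    simp
  refine ⟨k, ?_⟩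
  rw [id_gcomp, hk G (isFiniteCopower_self V G)]
  refine (isFiniteCopower_self V G).hom_ext ?_
  rw [hv _ _ (hv' _ _), ← hv G (hT.unit _) (hT.unit_counit X), hT.unit_gcomp_lift]

end Density

/-! ### Weighted limits in the enriched case. -/

section Limits

variable {V : Type u₁} [Category.{v₁} V] [MonoidalCategory V] [MonoidalClosed V]

local infixr:85 " ⋄ " => gcomp

open MonoidalClosed

section

variable {J : Type u₀} [EnrichedCategory V J] {K : Type u₂} [EnrichedCategory V K]
  {W : EnrichedFunctor V J V} {D : EnrichedFunctor V J K}

theorem isWeightedConeFamily_gcomp {X T : K} {Z : V} (f : Z ⟶ (X ⟶[V] T))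
    {π : ∀ j : J, W.obj j ⟶ (T ⟶[V] D.obj j)}
    (hπ : ∀ i j : J, uncurry (W.map i j) ≫ π j = π i ⋄ D.map i j) :
    IsWeightedConeFamily W D X Z fun j => f ⋄ π j := by
  intro i j
  change _ = (f ⋄ π i) ⋄ D.map i j
  rw [gcomp_assoc, ← gcomp_comp, hπ]

theorem IsWeightedConeFamily.gcomp {X Y : K} {S Z : V} (f : S ⟶ (Y ⟶[V] X))
    {φ : ∀ j : J, Z ⊗ W.obj j ⟶ (X ⟶[V] D.obj j)} (hφ : IsWeightedConeFamily W D X Z φ) :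
    IsWeightedConeFamily W D Y (S ⊗ Z) fun j => (α_ S Z (W.obj j)).hom ≫ f ⋄ φ j := by
  intro i j
  have h : _ = φ i ⋄ D.map i j := hφ i j
  change _ = ((α_ S Z (W.obj i)).hom ≫ f ⋄ φ i) ⋄ D.map i j
  rw [comp_gcomp, gcomp_assoc, ← h, gcomp_comp, gcomp_comp, associator_naturality_right_assoc,
    pentagon_assoc]

end

variable [BraidedCategory V]

/-- The object of `V`-natural transformations from `W` to `K(G, D -)`. -/
theorem exists_hom_weightedLimit [Limits.HasLimits V] {J : Type v₁} [EnrichedCategory V J]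
    {K : Type u₂} [EnrichedCategory V K] (W : EnrichedFunctor V J V) (D : EnrichedFunctor V J K)
    (G : K) :
    ∃ (P : V) (π : ∀ j : J, P ⊗ W.obj j ⟶ (G ⟶[V] D.obj j)), IsWeightedConeFamily W D G P π ∧
      ∀ (Z : V) (φ : ∀ j : J, Z ⊗ W.obj j ⟶ (G ⟶[V] D.obj j)),
        IsWeightedConeFamily W D G Z φ → ∃! k : Z ⟶ P, ∀ j, k ▷ W.obj j ≫ π j = φ j := by
  -- The usual end: the equalizer of `∏ [W j, K(G, D j)] ⇉ ∏ [W i ⊗ J(i,j), K(G, D j)]`. Braidings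
  -- appear because `curry` removes a left factor, while cone families carry the weight on the
  -- right.
  let B (j : J) : V := (ihom (W.obj j)).obj (G ⟶[V] D.obj j)
  let e (j : J) : (∏ᶜ B) ⊗ W.obj j ⟶ (G ⟶[V] D.obj j) :=
    (β_ _ _).hom ≫ uncurry (Limits.Pi.π B j)
  have he {Z : V} (k : Z ⟶ ∏ᶜ B) (j : J) :
      k ▷ W.obj j ≫ e j = (β_ _ _).hom ≫ uncurry (k ≫ Limits.Pi.π B j) := by
    simp only [e, uncurry_natural_left, BraidedCategory.braiding_naturality_left_assoc]
  let C (p : J × J) : V := (ihom (W.obj p.1 ⊗ (p.1 ⟶[V] p.2))).obj (G ⟶[V] D.obj p.2)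
  let l (p : J × J) : (∏ᶜ B) ⊗ W.obj p.1 ⊗ (p.1 ⟶[V] p.2) ⟶ (G ⟶[V] D.obj p.2) :=
    _ ◁ uncurry (W.map p.1 p.2) ≫ e p.2
  let r (p : J × J) : (∏ᶜ B) ⊗ W.obj p.1 ⊗ (p.1 ⟶[V] p.2) ⟶ (G ⟶[V] D.obj p.2) :=
    (α_ _ _ _).inv ≫ e p.1 ⋄ D.map p.1 p.2
  let f : (∏ᶜ B) ⟶ ∏ᶜ C := Limits.Pi.lift fun p => curry ((β_ _ _).inv ≫ l p)
  let g : (∏ᶜ B) ⟶ ∏ᶜ C := Limits.Pi.lift fun p => curry ((β_ _ _).inv ≫ r p)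
  have hfg {Z : V} (k : Z ⟶ ∏ᶜ B) :
      k ≫ f = k ≫ g ↔ IsWeightedConeFamily W D G Z fun j => k ▷ W.obj j ≫ e j := by
    have h1 : k ≫ f = k ≫ g ↔ ∀ p : J × J, k ▷ _ ≫ l p = k ▷ _ ≫ r p := by
      have h2 (x : ∀ p : J × J, (∏ᶜ B) ⊗ W.obj p.1 ⊗ (p.1 ⟶[V] p.2) ⟶ (G ⟶[V] D.obj p.2))
          (p : J × J) : (k ≫ Limits.Pi.lift fun p => (curry ((β_ _ _).inv ≫ x p) : _ ⟶ C p)) ≫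
            Limits.Pi.π C p = curry ((β_ _ _).inv ≫ k ▷ _ ≫ x p) := by
        rw [Category.assoc, Limits.Pi.lift_π, ← curry_natural_left,
          BraidedCategory.braiding_inv_naturality_right_assoc]
      refine ⟨fun h p => ?_, fun h => Limits.Pi.hom_ext _ _ fun p => ?_⟩
      · have := (h2 l p).symm.trans ((congrArg (· ≫ Limits.Pi.π C p) h).trans (h2 r p))
        exact (cancel_epi _).1 (curry_injective this)
      · rw [h2, h2, h p]
    rw [h1, Prod.forall]
    refine forall₂_congr fun i j => ?_
    change _ ↔ _ = (k ▷ W.obj i ≫ e i) ⋄ D.map i j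
    rw [comp_gcomp, ← cancel_epi (α_ Z (W.obj i) (i ⟶[V] j)).hom]
    simp only [l, r]
    rw [associator_inv_naturality_left_assoc, Iso.hom_inv_id_assoc, whisker_exchange_assoc]
  refine ⟨Limits.equalizer f g, fun j => Limits.equalizer.ι f g ▷ W.obj j ≫ e j,
    (hfg _).1 (Limits.equalizer.condition f g), fun Z φ hφ => ?_⟩
  have hk (j : J) : Limits.Pi.lift (fun j => (curry ((β_ Z (W.obj j)).inv ≫ φ j) : Z ⟶ B j)) ▷ W.obj j ≫
      e j = φ j := by
    rw [he, Limits.Pi.lift_π, uncurry_curry, Iso.hom_inv_id_assoc]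
  have hk' : (fun j => Limits.Pi.lift (fun j => (curry ((β_ Z (W.obj j)).inv ≫ φ j) : Z ⟶ B j)) ▷
      W.obj j ≫ e j) = φ := funext hk
  refine ⟨Limits.equalizer.lift (Limits.Pi.lift fun j => curry ((β_ Z (W.obj j)).inv ≫ φ j))
    ((hfg _).2 (by rwa [hk'])), fun j => ?_, fun k₁ hk₁ => ?_⟩
  · rw [← comp_whiskerRight_assoc, Limits.equalizer.lift_ι, hk]
  · refine Limits.equalizer.hom_ext (Limits.Pi.hom_ext _ _ fun j => ?_)
    refine uncurry_injective ((cancel_epi (β_ Z (W.obj j)).hom).1 ?_)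
    rw [Limits.equalizer.lift_ι, ← he, ← he, hk, comp_whiskerRight, Category.assoc, hk₁]


theorem isComplete_of_isDense [Limits.HasLimits V] {K : Type u₂} [Category.{v₂} K]
    [EnrichedOrdinaryCategory V K] {G : K} (hcoeq : HasReflexiveCoequalizers V K)
    (hT : HasTensors V G) (hd : IsDense V (IsFiniteCopower V G)) : IsComplete V K := by
  intro J _ W D
  obtain ⟨P, π, hπ, hP⟩ := exists_hom_weightedLimit W D G
  have Pext {Z : V} {k k' : Z ⟶ P} (h : ∀ j, k ▷ W.obj j ≫ π j = k' ▷ W.obj j ≫ π j) :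
      k = k' := by
    refine (hP Z (fun j => k' ▷ W.obj j ≫ π j) fun i j => ?_).unique h fun _ => rfl
    have hπij : _ = π i ⋄ D.map i j := hπ i j
    change _ = (k' ▷ _ ≫ π i) ⋄ D.map i j
    rw [comp_gcomp, ← hπij, whisker_exchange_assoc, associator_naturality_left_assoc]
  let p (j : J) : W.obj j ⟶ (hT.obj P ⟶[V] D.obj j) := hT.lift (π j)
  have hp (j : J) : hT.unit P ⋄ p j = π j := hT.unit_gcomp_lift _
  have hpnat (i j : J) : uncurry (W.map i j) ≫ p j = p i ⋄ D.map i j := by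
    refine hT.ext ?_
    rw [gcomp_comp, gcomp_assoc', hp, hp, Iso.eq_inv_comp]
    exact hπ i j
  -- `a` is the action of the monad `K(G, - ⊗ G)` on `P`. The pair coequalized below transposes to
  -- the counit of `P ⊗ G` and `a ⊗ G`, as in Beck's theorem.
  obtain ⟨a, ha, -⟩ := hP (G ⟶[V] hT.obj P) (fun j => 𝟙 _ ⋄ p j)
    (isWeightedConeFamily_gcomp _ hpnat)
  have hua : hT.unit P ≫ a = 𝟙 P := Pext fun j => by
    rw [comp_whiskerRight_assoc, ha, ← gcomp_eq_left, hp, id_whiskerRight, Category.id_comp]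
  obtain ⟨Q, q, hq, hQ⟩ := hT.exists_quotient hcoeq (𝟙 _) (a ≫ hT.unit P) (hT.unit P)
    (Category.comp_id _) (by rw [reassoc_of% hua])
  let r : P ⟶ (G ⟶[V] Q) := hT.unit P ≫ eHomWhiskerLeft V G q
  rw [Category.id_comp, Category.assoc] at hq
  choose κ hκ _ using fun j : J => hQ (D.obj j) (W.obj j) (p j) (by
    rw [comp_gcomp, hp, ha])
  have hrκ (j : J) : r ⋄ κ j = π j := by rw [whiskerLeft_gcomp, hκ, hp]
  have Qext {Y : K} {Z : V} {k k' : Z ⟶ (Q ⟶[V] Y)} (h : r ⋄ k = r ⋄ k') : k = k' := by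
    rw [whiskerLeft_gcomp, whiskerLeft_gcomp] at h
    refine (hQ Y Z (k' ≫ eHomWhiskerRight V q Y) ?_).unique (hT.ext h) rfl
    rw [← whiskerLeft_gcomp, ← whiskerLeft_gcomp, Category.id_comp, Category.assoc, ← hq]
  have hκnat (i j : J) : uncurry (W.map i j) ≫ κ j = κ i ⋄ D.map i j := by
    refine Qext ?_
    rw [gcomp_comp, gcomp_assoc', hrκ, hrκ, Iso.eq_inv_comp]
    exact hπ i j
  -- The transpose `ψ` of a cone on `X` is a homomorphism into `P`; since `hq` gives `K(G, q) = a ≫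
  -- r`, `ψ ≫ r` meets the criterion of `exists_hom_of_isDense`.
  have main (X : K) (Z : V) (φ : ∀ j : J, Z ⊗ W.obj j ⟶ (X ⟶[V] D.obj j))
      (ψ : (G ⟶[V] X) ⊗ Z ⟶ P)
      (hψ : ∀ j, ψ ▷ W.obj j ≫ π j = (α_ _ _ _).hom ≫ 𝟙 _ ⋄ φ j) :
      ∃ k : Z ⟶ (X ⟶[V] Q), 𝟙 (G ⟶[V] X) ⋄ k = ψ ≫ r := by
    let ψ' : Z ⟶ (hT.obj (G ⟶[V] X) ⟶[V] hT.obj P) := hT.lift (ψ ≫ hT.unit P)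
    have hψ' : hT.unit _ ⋄ ψ' = ψ ≫ hT.unit P := hT.unit_gcomp_lift _
    have hψq : hT.lift (ψ ≫ r) = ψ' ≫ eHomWhiskerLeft V _ q := hT.ext (by
      rw [hT.unit_gcomp_lift, gcomp_whiskerLeft, hψ', Category.assoc])
    refine exists_hom_of_isDense hd hT _ ?_
    have hψp (j : J) : ψ' ⋄ p j = φ j ≫ eHomWhiskerRight V (hT.counit X) _ := hT.ext (by
      rw [gcomp_assoc', hψ', comp_gcomp, hp, hψ, Iso.inv_hom_id_assoc,
        hT.unit_gcomp_whiskerRight_counit])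
    have hψa : 𝟙 (G ⟶[V] hT.obj (G ⟶[V] X)) ⋄ ψ' ≫ a =
        eHomWhiskerLeft V G (hT.counit X) ▷ Z ≫ ψ := Pext fun j => by
      rw [comp_whiskerRight_assoc, ha, ← gcomp_eq_left, gcomp_assoc, hψp,
        comp_whiskerRight_assoc, hψ, associator_naturality_left_assoc, ← gcomp_eq_left,
        ← whiskerLeft_gcomp, Category.id_comp]
    rw [hψq, gcomp_whiskerLeft, hq, reassoc_of% hψa]
  obtain ⟨s, hs, -⟩ := hP (G ⟶[V] Q) (fun j => 𝟙 _ ⋄ κ j)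
    (isWeightedConeFamily_gcomp _ hκnat)
  have hrs : r ≫ s = 𝟙 P := Pext fun j => by
    rw [comp_whiskerRight_assoc, hs, ← gcomp_eq_left, hrκ, id_whiskerRight, Category.id_comp]
  -- By `main` for the cone `κ`, `s ≫ r` is composition with some `k : 𝟙_ V ⟶ (Q ⟶[V] Q)`. As `r ≫ s
  -- ≫ r = r`, this `k` agrees with the identity along `r`, hence equals it.
  have hsr : s ≫ r = 𝟙 _ := by
    obtain ⟨k, hk⟩ := main Q (𝟙_ V) (fun j => eId V Q ⋄ κ j) ((ρ_ _).hom ≫ s) fun j => by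
      rw [comp_whiskerRight_assoc, hs, eId_gcomp, gcomp_comp, triangle_assoc]
    have hk' : k = eId V Q := Qext (by
      rw [gcomp_eq_left, hk, gcomp_eId, Category.assoc, rightUnitor_naturality_assoc,
        reassoc_of% hrs])
    rw [hk', gcomp_eId, Category.assoc] at hk
    exact ((cancel_epi _).1 hk).symm
  refine ⟨Q, κ, hκnat, fun X Z φ hφ => ?_⟩
  obtain ⟨ψ, hψ, -⟩ := hP _ _ (hφ.gcomp (𝟙 (G ⟶[V] X)))
  obtain ⟨k, hk⟩ := main X Z φ ψ hψ
  refine ⟨k, fun j => hom_ext_of_isDense hd ?_, fun k' hk' => hom_ext_of_isDense hd ?_⟩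
  · change 𝟙 _ ⋄ k ⋄ κ j = _
    rw [gcomp_assoc', hk, comp_gcomp, hrκ, hψ, Iso.inv_hom_id_assoc]
  · have h : 𝟙 (G ⟶[V] X) ⋄ k' ≫ s = ψ := Pext fun j => by
      rw [comp_whiskerRight_assoc, hs, ← gcomp_eq_left, gcomp_assoc, hψ]
      exact congrArg (fun t => _ ≫ 𝟙 _ ⋄ t) (hk' j)
    rw [hk, ← h, Category.assoc, hsr, Category.comp_id]

end Limits

/-! ### Weighted colimits in the enriched case. -/

section Colimits

variable {V : Type u₁} [Category.{v₁} V] [MonoidalCategory V] [MonoidalClosed V]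
  [BraidedCategory V]

local infixr:85 " ⋄ " => gcomp

open MonoidalClosed Limits

/-- By closedness and the braiding, `- ⊗ Z` preserves coproducts. -/
theorem sigma_whiskerRight_hom_ext {E : Type u₀} {f : E → V} [HasCoproduct f] {Y Z : V}
    {k k' : (∐ f) ⊗ Z ⟶ Y} (h : ∀ e, Sigma.ι f e ▷ Z ≫ k = Sigma.ι f e ▷ Z ≫ k') : k = k' := by
  refine (cancel_epi (β_ Z (∐ f)).hom).1 (curry_injective (Sigma.hom_ext _ _ fun e => ?_))
  rw [← curry_natural_left, ← curry_natural_left,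
    BraidedCategory.braiding_naturality_right_assoc,
    BraidedCategory.braiding_naturality_right_assoc, h]

theorem exists_sigma_whiskerRight_desc {E : Type u₀} {f : E → V} [HasCoproduct f] {Y Z : V}
    (h : ∀ e, f e ⊗ Z ⟶ Y) : ∃ k : (∐ f) ⊗ Z ⟶ Y, ∀ e, Sigma.ι f e ▷ Z ≫ k = h e := by
  refine ⟨(β_ _ _).hom ≫ uncurry (Sigma.desc fun e => curry ((β_ (f e) Z).inv ≫ h e)),
    fun e => ?_⟩
  rw [BraidedCategory.braiding_naturality_left_assoc, ← uncurry_natural_left, Sigma.ι_desc,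
    uncurry_curry, Iso.hom_inv_id_assoc]

/-- The quotient of a tensor `P ⊗ G` by a family of pairs of generalized elements of
`K(G, P ⊗ G)`. -/
theorem HasTensors.exists_quotient_family [HasColimits V] {K : Type u₂} [Category.{v₂} K]
    [EnrichedOrdinaryCategory V K] {G : K} (hcoeq : HasReflexiveCoequalizers V K)
    (hT : HasTensors V G) {P : V} {E : Type v₁} {R : E → V}
    (a b : ∀ e, R e ⟶ (G ⟶[V] hT.obj P)) :
    ∃ (Q : K) (q : hT.obj P ⟶ Q),
      (∀ e, a e ≫ eHomWhiskerLeft V G q = b e ≫ eHomWhiskerLeft V G q) ∧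
      ∀ (Y : K) (Z : V) (h : Z ⟶ (hT.obj P ⟶[V] Y)), (∀ e, a e ⋄ h = b e ⋄ h) →
        ∃! k : Z ⟶ (Q ⟶[V] Y), k ≫ eHomWhiskerRight V q Y = h := by
  -- An extra summand `P`, sent to the unit by both members, makes the pair reflexive.
  let R' (o : Option E) : V := o.elim P R
  let a' : ∀ o, R' o ⟶ (G ⟶[V] hT.obj P) := fun | none => hT.unit P | some e => a e
  let b' : ∀ o, R' o ⟶ (G ⟶[V] hT.obj P) := fun | none => hT.unit P | some e => b e
  obtain ⟨Q, q, hq, hQ⟩ := hT.exists_quotient hcoeq (Sigma.desc a') (Sigma.desc b')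
    (Sigma.ι R' none) (Sigma.ι_desc _ _) (Sigma.ι_desc _ _)
  refine ⟨Q, q, fun e => ?_, fun Y Z h hh => hQ Y Z h (sigma_whiskerRight_hom_ext ?_)⟩
  · have := congrArg (Sigma.ι R' (some e) ≫ ·) hq
    simp only [Sigma.ι_desc_assoc] at this
    exact this
  · rintro (_ | e)
    · rw [← comp_gcomp, ← comp_gcomp, Sigma.ι_desc, Sigma.ι_desc]
    · rw [← comp_gcomp, ← comp_gcomp, Sigma.ι_desc, Sigma.ι_desc]
      exact hh e

theorem isCocomplete_of_isDense [HasColimits V] {K : Type u₂} [Category.{v₂} K]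
    [EnrichedOrdinaryCategory V K] {G : K} (hcoeq : HasReflexiveCoequalizers V K)
    (hT : HasTensors V G) (hd : IsDense V (IsFiniteCopower V G)) : IsCocomplete V K := by
  intro J _ W D
  let f (j : J) : V := (G ⟶[V] D.obj j) ⊗ W.obj (op j)
  let n (j : J) : f j ⟶ (G ⟶[V] hT.obj (∐ f)) := Sigma.ι f j ≫ hT.unit _
  let x (j : J) : W.obj (op j) ⟶ (hT.obj (G ⟶[V] D.obj j) ⟶[V] hT.obj (∐ f)) := hT.lift (n j)
  have hx (j : J) : hT.unit _ ⋄ x j = n j := hT.unit_gcomp_lift _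
  have next {Y : K} {Z : V} {k k' : Z ⟶ (hT.obj (∐ f) ⟶[V] Y)} (h : ∀ j, n j ⋄ k = n j ⋄ k') :
      k = k' :=
    hT.ext (sigma_whiskerRight_hom_ext fun j => by rw [← comp_gcomp, ← comp_gcomp]; exact h j)
  -- The relations indexed by `j` make `n j ≫ K(G, q)` a homomorphism, so that density turns it into
  -- `κ j`. Those indexed by `(i, j)` make the family `κ` natural.
  let R : J ⊕ J × J → V := Sum.elim
    (fun j => (G ⟶[V] hT.obj (G ⟶[V] D.obj j)) ⊗ W.obj (op j))
    (fun p => ((G ⟶[V] D.obj p.1) ⊗ (p.1 ⟶[V] p.2)) ⊗ W.obj (op p.2))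
  let a : ∀ e, R e ⟶ (G ⟶[V] hT.obj (∐ f)) := fun
    | .inl j => 𝟙 _ ⋄ x j
    | .inr (i, j) => (𝟙 _ ⋄ D.map i j) ▷ W.obj (op j) ≫ n j
  let b : ∀ e, R e ⟶ (G ⟶[V] hT.obj (∐ f)) := fun
    | .inl j => eHomWhiskerLeft V G (hT.counit _) ▷ W.obj (op j) ≫ n j
    | .inr (i, j) => (α_ _ _ _).hom ≫ (G ⟶[V] D.obj i) ◁ weightAct W i j ≫ n i
  obtain ⟨Q, q, hq, hQ⟩ := hT.exists_quotient_family hcoeq a b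
  have hq₁ (j : J) : 𝟙 _ ⋄ x j ≫ eHomWhiskerLeft V G q =
      (eHomWhiskerLeft V G (hT.counit _) ▷ W.obj (op j) ≫ n j) ≫ eHomWhiskerLeft V G q :=
    hq (.inl j)
  have hq₂ (i j : J) : ((𝟙 _ ⋄ D.map i j) ▷ W.obj (op j) ≫ n j) ≫ eHomWhiskerLeft V G q =
      ((α_ _ _ _).hom ≫ (G ⟶[V] D.obj i) ◁ weightAct W i j ≫ n i) ≫ eHomWhiskerLeft V G q :=
    hq (.inr (i, j))
  have Qext {Y : K} {Z : V} {k k' : Z ⟶ (Q ⟶[V] Y)}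
      (h : k ≫ eHomWhiskerRight V q Y = k' ≫ eHomWhiskerRight V q Y) : k = k' := by
    refine (hQ Y Z (k' ≫ eHomWhiskerRight V q Y) fun e => ?_).unique h rfl
    rw [← whiskerLeft_gcomp, ← whiskerLeft_gcomp, hq]
  choose κ hκ using fun j : J => exists_hom_of_isDense hd hT (X := D.obj j)
    (n j ≫ eHomWhiskerLeft V G q) (by
      have h : hT.lift (n j ≫ eHomWhiskerLeft V G q) = x j ≫ eHomWhiskerLeft V _ q :=
        hT.ext (by rw [hT.unit_gcomp_lift, gcomp_whiskerLeft, hx])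
      rw [h, gcomp_whiskerLeft, hq₁, Category.assoc])
  have hκn {Y : K} {Z : V} (j : J) (k : Z ⟶ (Q ⟶[V] Y)) :
      𝟙 _ ⋄ κ j ⋄ k = (α_ _ _ _).inv ≫ n j ⋄ (k ≫ eHomWhiskerRight V q Y) := by
    rw [gcomp_assoc', hκ, whiskerLeft_gcomp]
  refine ⟨Q, κ, fun i j => hom_ext_of_isDense hd ?_, fun X Z φ hφ => ?_⟩
  · change _ = 𝟙 (G ⟶[V] D.obj i) ⋄ D.map i j ⋄ κ j
    rw [gcomp_comp, hκ, gcomp_assoc', Iso.eq_inv_comp, gcomp_eq_left (_ ⋄ _), hκ]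
    simpa only [Category.assoc] using (hq₂ i j).symm
  · obtain ⟨k, hk⟩ := exists_sigma_whiskerRight_desc (f := f)
      fun j => (α_ _ _ _).hom ≫ 𝟙 (G ⟶[V] D.obj j) ⋄ φ j
    have hnk (j : J) : n j ⋄ hT.lift k = (α_ _ _ _).hom ≫ 𝟙 (G ⟶[V] D.obj j) ⋄ φ j := by
      rw [comp_gcomp, hT.unit_gcomp_lift, hk]
    have hxk (j : J) : x j ⋄ hT.lift k = φ j ≫ eHomWhiskerRight V (hT.counit _) X :=
      hT.ext (by
        rw [gcomp_assoc', hx, hnk, Iso.inv_hom_id_assoc, hT.unit_gcomp_whiskerRight_counit])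
    -- The first relations are respected because `x j ⋄ hT.lift k` factors through the counit, by
    -- `hxk`; the second because `φ` is natural.
    obtain ⟨l, hl, -⟩ := hQ X Z (hT.lift k) (by
      rintro (j | ⟨i, j⟩)
      · change (𝟙 _ ⋄ x j) ⋄ hT.lift k =
          (eHomWhiskerLeft V G (hT.counit _) ▷ W.obj (op j) ≫ n j) ⋄ hT.lift k
        rw [gcomp_assoc, hxk, ← whiskerLeft_gcomp, Category.id_comp, comp_gcomp, hnk,
          associator_naturality_left_assoc, ← gcomp_eq_left]
      · change ((𝟙 _ ⋄ D.map i j) ▷ W.obj (op j) ≫ n j) ⋄ hT.lift k =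
          ((α_ _ _ _).hom ≫ (G ⟶[V] D.obj i) ◁ weightAct W i j ≫ n i) ⋄ hT.lift k
        have h : _ = _ ≫ D.map i j ⋄ φ j := hφ i j
        rw [comp_gcomp, hnk, associator_naturality_left_assoc, ← gcomp_eq_left, gcomp_assoc,
          comp_gcomp, comp_gcomp, hnk, associator_naturality_middle_assoc, ← gcomp_comp, h,
          gcomp_comp, pentagon_assoc])
    refine ⟨l, fun j => hom_ext_of_isDense hd ?_, fun l' hl' => Qext (next fun j => ?_)⟩
    · change 𝟙 _ ⋄ κ j ⋄ l = _
      rw [hκn, hl, hnk, Iso.inv_hom_id_assoc]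
    · rw [hl, hnk, ← Iso.inv_comp_eq, ← hκn]
      exact congrArg (𝟙 _ ⋄ ·) (hl' j)

end Colimits

end EnrichedNotions

theorem propositionP :
    -- enriched categories with a dense subcategory of finite copowers
    (∀ (V : Type u₁) [Category.{v₁} V] [MonoidalCategory V] [SymmetricCategory V]
        [MonoidalClosed V]
        (K : Type u₂) [Category.{v₂} K] [EnrichedOrdinaryCategory V K] (G : K),
      EnrichedNotions.HasReflexiveCoequalizers V K →
      EnrichedNotions.HasTensors V G →
      EnrichedNotions.IsDense V (EnrichedNotions.IsFiniteCopower V G) →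
        (Limits.HasLimits V → EnrichedNotions.IsComplete V K) ∧
        (Limits.HasColimits V → EnrichedNotions.IsCocomplete V K)) ∧
    -- order-enriched categories with a subvarietal generator
    (∀ (K : Type u₂) [Category.{v₂} K] [OrderEnriched K],
      OrderNotions.HasSubkernelPairs K →
      OrderNotions.HasReflexiveCoinserters K →
      (∃ G : K, OrderNotions.IsSubvarietalGenerator G) →
        OrderNotions.IsComplete K ∧ OrderNotions.IsCocomplete K) := by
  refine ⟨fun V _ _ _ _ K _ _ G hcoeq hT hd => ⟨fun _ => ?_, fun _ => ?_⟩,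
    fun K _ _ hker hcoins ⟨G, hG⟩ => ⟨hG.isComplete hker hcoins, hG.isCocomplete hker hcoins⟩⟩
  · exact EnrichedNotions.isComplete_of_isDense hcoeq hT hd
  · exact EnrichedNotions.isCocomplete_of_isDense hcoeq hT hd
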